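/- **Graphs and entropy.** A graph has directed edges $e$ with originating and terminating vertices and a fixed-point free reversal $e\mapsto\bar e$. A subgraph consists of sets of vertices and of directed edges that are closed under taking endpoints and reversal; it is proper if it is not the whole graph. A length function $\ell$ on a finite graph $G$ assigns to every edge a positive real number with $\ell(\bar e)=\ell(e)$. A circuit is a nonempty sequence $(e_1,\dots,e_n)$ of directed edges such that, with indices modulo $n$, $e_{i+1}$ starts where $e_i$ ends and $e_i\neq\bar e_{i+1}$; its length is $\sum_i\ell(e_i)$. The entropy of $\ell$ is $$\mathfrak h_G(\ell)=\lim_{t\to\infty}\frac1t\log\bigl|\{\text{circuits of } G \text{ of length at most } t\}\bigr|$$ (and $0$ if $G$ has no circuits), and $\mathcal M^1(G)$ is the set of length functions with $\mathfrak h_G(\ell)=1$. The $r$-rose $\mathcal R_r$ is the graph with one vertex and $r$ loops. **Proposition.** Let $B_r=\frac15$ for $r<29$ and $B_r=1-\frac{4}{\log(2r-3)}$ for $r\ge 29$. Then for every $r\ge 3$: 1. $B_r>0$; 2. for every $\ell\in\mathcal M^1(\mathcal R_r)$ there is a proper subgraph $G'\subset\mathcal R_r$ with $\mathfrak h_{G'}(\ell|_{G'})\ge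 B_r$; in other words, the maximum of $\mathfrak h_{G'}(\ell|_{G'})$ over all proper subgraphs $G'\subset\mathcal R_r$ exists and is at least $B_r$; 3. $\mathcal M^1(\mathcal R_r)$ is non-empty, and the infimum of this maximum over all $\ell\in\mathcal M^1(\mathcal R_r)$ is at least $B_r$. Moreover, $\lim_{r\to\infty}B_r=1$. -/

import Mathlib

open Filter Topology

/-- A graph in the sense of Serre: vertices, directed edges, originating and terminating
vertices, and a fixed-point free involution reversing the direction of an edge. -/
structure SerreGraph where
  V : Type
  E : Type
  o : E → V
  τ : E → V
  bar : E → E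
  bar_bar : ∀ e, bar (bar e) = e
  bar_ne : ∀ e, bar e ≠ e
  o_eq : ∀ e, o e = τ (bar e)

namespace SerreGraph

/-- A length function: a positive real number for every undirected edge, that is, a positive
function on the directed edges which takes the same value on an edge and on its reverse. -/
structure LengthFunction (G : SerreGraph) where
  toFun : G.E → ℝ
  pos : ∀ e, 0 < toFun e
  bar_eq : ∀ e, toFun (G.bar e) = toFun e

/-- The directed edge `e'` may follow the directed edge `e` in a path without backtracking. -/
def Follows (G : SerreGraph) (e e' : G.E) : Prop :=
  G.τ e = G.o e' ∧ e ≠ G.bar e'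

/-- A (based) circuit: a nonempty finite sequence of directed edges which is a cyclically
reduced closed path. -/
structure IsCircuit (G : SerreGraph) (γ : List G.E) : Prop where
  ne_nil : γ ≠ []
  chain : γ.IsChain G.Follows
  close : G.Follows (γ.getLast ne_nil) (γ.head ne_nil)

/-- The length of a sequence of edges. -/
noncomputable def LengthFunction.length {G : SerreGraph} (ℓ : G.LengthFunction)
    (γ : List G.E) : ℝ :=
  (γ.map ℓ.toFun).sum

/-- The set of circuits of length at most `t`. For a finite graph it is finite. -/
def circuits (G : SerreGraph) (ℓ : G.LengthFunction) (t : ℝ) : Set (List G.E) :=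
  {γ | G.IsCircuit γ ∧ ℓ.length γ ≤ t}

/-- `G.HasEntropy ℓ h`: for the finite graph `G`, the limit `lim (1/t) log |C(t)|` as `t → ∞`,
with `C(t)` the set of circuits of length at most `t`, exists and equals `h`. (A graph without
circuits has entropy `0`, since `Real.log 0 = 0`.) -/
def HasEntropy (G : SerreGraph) (ℓ : G.LengthFunction) (h : ℝ) : Prop :=
  Tendsto (fun t : ℝ => (1 / t) * Real.log ((G.circuits ℓ t).ncard : ℝ)) atTop (𝓝 h)

/-- The set of length functions of unit entropy. -/
def unitEntropy (G : SerreGraph) : Set G.LengthFunction :=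
  {ℓ | G.HasEntropy ℓ 1}

/-- A subgraph: a set of vertices and a set of directed edges that is closed under reversal and
whose members have their endpoints in the set of vertices. -/
structure Subgraph (G : SerreGraph) where
  verts : Set G.V
  edges : Set G.E
  o_mem : ∀ e ∈ edges, G.o e ∈ verts
  τ_mem : ∀ e ∈ edges, G.τ e ∈ verts
  bar_mem : ∀ e ∈ edges, G.bar e ∈ edges

/-- A subgraph is proper if it is not the whole graph. -/
def Subgraph.IsProper {G : SerreGraph} (H : G.Subgraph) : Prop :=
  ¬ (H.verts = Set.univ ∧ H.edges = Set.univ)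

/-- A subgraph as a graph in its own right. -/
def Subgraph.toGraph {G : SerreGraph} (H : G.Subgraph) : SerreGraph where
  V := H.verts
  E := H.edges
  o e := ⟨G.o e.1, H.o_mem e.1 e.2⟩
  τ e := ⟨G.τ e.1, H.τ_mem e.1 e.2⟩
  bar e := ⟨G.bar e.1, H.bar_mem e.1 e.2⟩
  bar_bar e := Subtype.ext (G.bar_bar e.1)
  bar_ne e h := G.bar_ne e.1 (congrArg Subtype.val h)
  o_eq e := Subtype.ext (G.o_eq e.1)

/-- The restriction of a length function to a subgraph. -/
def LengthFunction.restrict {G : SerreGraph} (ℓ : G.LengthFunction) (H : G.Subgraph) :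
    H.toGraph.LengthFunction where
  toFun e := ℓ.toFun e.1
  pos e := ℓ.pos e.1
  bar_eq e := ℓ.bar_eq e.1

/-- The set of entropies of the restrictions of `ℓ` to the proper subgraphs of `G`. -/
def subgraphEntropies (G : SerreGraph) (ℓ : G.LengthFunction) : Set ℝ :=
  {h | ∃ H : G.Subgraph, H.IsProper ∧ H.toGraph.HasEntropy (ℓ.restrict H) h}

/-- The largest entropy of a restriction of `ℓ` to a proper subgraph of `G`. -/
noncomputable def entropySup (G : SerreGraph) (ℓ : G.LengthFunction) : ℝ :=
  sSup (G.subgraphEntropies ℓ)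

/-- The infimum of `entropySup` over all length functions of unit entropy. -/
noncomputable def entropyInf (G : SerreGraph) : ℝ :=
  sInf (G.entropySup '' G.unitEntropy)

/-- The `r`-rose: one vertex and `r` loops; `(i, true)` and `(i, false)` are the two directions
of the `i`-th loop. -/
def rose (r : ℕ) : SerreGraph where
  V := Unit
  E := Fin r × Bool
  o _ := ()
  τ _ := ()
  bar e := (e.1, !e.2)
  bar_bar e := by simp
  bar_ne e h := by
    have h2 := congrArg Prod.snd h
    simp at h2
  o_eq _ := rfl

end SerreGraph

/-! In a one-vertex graph the only restriction on consecutive edges is that there is no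
backtracking, so the number of continuations of `e` satisfies `N_e(s) = 1 + ∑ N_{e'}(s - ℓ e')`,
summed over `e' ≠ bar e`. The ansatz `N_e(s) = v_e * exp (h * s)`, with `v` invariant under reversal
and the constant 1 ignored, forces `v_e` to be proportional to `1 - 1 / (exp (h * ℓ e) + 1)` and `∑
1 / (exp (h * ℓ e) + 1) = 1`. Conversely, a positive root `h` of this equation traps the counts
between multiples of `exp (h * s)` (`continuations_bounds`). Circuits and continuations differ only
by boundedly many edges, so `h` is the entropy (`hasEntropy_of_sum_eq_one`).

The proposition thus becomes an inequality. For unit entropy, the numbers `a_i = 1 / (exp (x_i) +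
1)`, one for each petal, add up to 1/2. Removing the longest petal loses only the smallest `a_k ≤ 1
/ (2 * r)`. Replacing `x_i` by `B * x_i` raises the other terms, and convexity of `exp` shows that
this makes up for the loss once `r / (r - 1) ^ 2 ≤ 1 - B` (`half_le_sum_erase`). The remaining rose
then has its root at or above `B`. Both formulas for `B_r` satisfy this condition. -/

namespace SerreGraph

/-! ### Counting paths without backtracking -/

variable {G : SerreGraph}

/-- The paths without backtracking of length at most `s` that may follow the edge `e`. -/
def continuations (ℓ : G.LengthFunction) (e : G.E) (s : ℝ) : Set (List G.E) :=
  {w | (e :: w).IsChain G.Follows ∧ ℓ.length w ≤ s}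

namespace LengthFunction

@[simp] lemma length_nil (ℓ : G.LengthFunction) : ℓ.length [] = 0 := by simp [length]

@[simp] lemma length_cons (ℓ : G.LengthFunction) (e : G.E) (w : List G.E) :
    ℓ.length (e :: w) = ℓ.toFun e + ℓ.length w := by simp [length]

@[simp] lemma length_append (ℓ : G.LengthFunction) (v w : List G.E) :
    ℓ.length (v ++ w) = ℓ.length v + ℓ.length w := by simp [length]

lemma length_nonneg (ℓ : G.LengthFunction) (w : List G.E) : 0 ≤ ℓ.length w := by
  induction w with
  | nil => simp
  | cons e w ih => rw [length_cons]; linarith [ℓ.pos e]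

end LengthFunction

lemma follows_iff (hG : ∀ e e', G.τ e = G.o e') (e e' : G.E) :
    G.Follows e e' ↔ e' ≠ G.bar e := by
  constructor
  · rintro ⟨-, h⟩ rfl
    exact h (G.bar_bar e).symm
  · intro h
    refine ⟨hG e e', ?_⟩
    rintro rfl
    exact h (G.bar_bar e').symm

lemma continuations_eq_empty (ℓ : G.LengthFunction) (e : G.E) {s : ℝ} (hs : s < 0) :
    continuations ℓ e s = ∅ := by
  ext w
  simp only [continuations, Set.mem_ofPred_eq, Set.mem_empty_iff_false, iff_false, not_and]
  intro _ h
  linarith [ℓ.length_nonneg w]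

open Classical in
/-- A nonempty continuation is a first edge followed by a continuation of that edge. -/
lemma ncard_continuations [Fintype G.E] (hG : ∀ e e', G.τ e = G.o e')
    (ℓ : G.LengthFunction) (e : G.E) {s : ℝ} (hs : 0 ≤ s)
    (hfin : ∀ e', (continuations ℓ e' (s - ℓ.toFun e')).Finite) :
    (continuations ℓ e s).Finite ∧
      (continuations ℓ e s).ncard =
        1 + ∑ e' ∈ Finset.univ.erase (G.bar e), (continuations ℓ e' (s - ℓ.toFun e')).ncard := by
  set F : Finset (List G.E) := insert [] ((Finset.univ.erase (G.bar e)).biUnion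
    fun e' => (hfin e').toFinset.image (List.cons e')) with hF
  have hPF : continuations ℓ e s = ↑F := by
    ext w
    rw [hF]
    cases w with
    | nil => simp [continuations, hs]
    | cons a w =>
      simp [continuations, follows_iff hG, le_sub_iff_add_le, add_comm, and_assoc]
      tauto
  rw [hPF]
  refine ⟨F.finite_toSet, ?_⟩
  rw [Set.ncard_coe_finset, hF, Finset.card_insert_of_notMem (by simp), add_comm,
    Finset.card_biUnion]
  · congr 1
    refine Finset.sum_congr rfl fun e' _ => ?_
    rw [Finset.card_image_of_injective _ List.cons_injective,
      Set.ncard_eq_toFinset_card _ (hfin e')]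
  · intro a _ b _ hab
    simp only [Function.onFun, Finset.disjoint_left, Finset.mem_image, not_exists, not_and]
    rintro _ ⟨v, -, rfl⟩ w - h
    exact hab (List.cons.inj h).1.symm

open Classical in
/-- The vector `1 - 1 / (exp (h * ℓ e) + 1)` is harmonic for the weighted transfer operator. -/
lemma sum_exp_mul_eq [Fintype G.E] (ℓ : G.LengthFunction) {h : ℝ}
    (hsum : ∑ e, 1 / (Real.exp (h * ℓ.toFun e) + 1) = 1) (e : G.E) (s : ℝ) :
    ∑ e' ∈ Finset.univ.erase (G.bar e),
        (1 - 1 / (Real.exp (h * ℓ.toFun e') + 1)) * Real.exp (h * (s - ℓ.toFun e')) =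
      (1 - 1 / (Real.exp (h * ℓ.toFun e) + 1)) * Real.exp (h * s) := by
  have key : ∀ e', (1 - 1 / (Real.exp (h * ℓ.toFun e') + 1)) * Real.exp (h * (s - ℓ.toFun e')) =
      1 / (Real.exp (h * ℓ.toFun e') + 1) * Real.exp (h * s) := by
    intro e'
    have h1 := Real.exp_pos (h * ℓ.toFun e')
    rw [mul_sub, Real.exp_sub]
    field_simp
    ring
  rw [Finset.sum_congr rfl fun e' _ => key e', ← Finset.sum_mul,
    Finset.sum_erase_eq_sub (Finset.mem_univ (G.bar e)), hsum, ℓ.bar_eq]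

lemma half_le_one_sub {x : ℝ} (hx : 0 ≤ x) : 1 / 2 ≤ 1 - 1 / (Real.exp x + 1) := by
  have h2 : 1 / (Real.exp x + 1) ≤ 1 / 2 :=
    one_div_le_one_div_of_le (by norm_num) (by linarith [Real.one_le_exp hx])
  linarith

lemma two_lt_card [Fintype G.E] (ℓ : G.LengthFunction) {h : ℝ} (hh : 0 < h)
    (hsum : ∑ e, 1 / (Real.exp (h * ℓ.toFun e) + 1) = 1) : 2 < Fintype.card G.E := by
  have hne : (Finset.univ : Finset G.E).Nonempty := by
    by_contra hcon
    rw [Finset.not_nonempty_iff_eq_empty] at hcon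
    simp [hcon] at hsum
  have hlt : ∑ e, 1 / (Real.exp (h * ℓ.toFun e) + 1) < ∑ _e : G.E, (1 / 2 : ℝ) := by
    refine Finset.sum_lt_sum_of_nonempty hne fun e _ => ?_
    exact one_div_lt_one_div_of_lt (by norm_num)
      (by linarith [Real.one_lt_exp_iff.mpr (mul_pos hh (ℓ.pos e))])
  rw [hsum, Finset.sum_const, Finset.card_univ, nsmul_eq_mul] at hlt
  have : (2 : ℝ) < Fintype.card G.E := by linarith
  exact_mod_cast this

/-- Induction on the number of steps of size `m` that exhaust `s`, using harmonicity. In the upper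
bound, the `- 1` absorbs the inhomogeneous 1 of the recursion: there are at least two successors, so
it reappears at least twice. The range `-K ≤ s` keeps the bound available after one edge is
subtracted; for negative `s` there the right side is still nonnegative, since the harmonic vector is
at least 1/2. In the lower bound the 1 is dropped, and for `0 ≤ s < K` the empty path suffices. -/
lemma continuations_bounds [Fintype G.E] (hG : ∀ e e', G.τ e = G.o e')
    (ℓ : G.LengthFunction) {h : ℝ} (hh : 0 < h)
    (hsum : ∑ e, 1 / (Real.exp (h * ℓ.toFun e) + 1) = 1)
    {m K : ℝ} (hm : 0 < m) (hml : ∀ e, m ≤ ℓ.toFun e) (hK : ∀ e, ℓ.toFun e ≤ K)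
    (e : G.E) (s : ℝ) :
    (continuations ℓ e s).Finite ∧
    (-K ≤ s → ((continuations ℓ e s).ncard : ℝ) ≤
      2 * Real.exp (h * K) * ((1 - 1 / (Real.exp (h * ℓ.toFun e) + 1)) * Real.exp (h * s)) - 1) ∧
    (0 ≤ s → Real.exp (-(h * K)) * ((1 - 1 / (Real.exp (h * ℓ.toFun e) + 1)) * Real.exp (h * s)) ≤
      (continuations ℓ e s).ncard) := by
  classical
  obtain ⟨n, hn⟩ := exists_nat_gt (s / m)
  rw [div_lt_iff₀ hm] at hn
  induction n generalizing e s with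
  | zero =>
    have hs : s < 0 := by simpa using hn
    have hemp := continuations_eq_empty ℓ e hs
    refine ⟨by simp [hemp], fun hKs => ?_, fun hs' => absurd hs' (not_le.mpr hs)⟩
    rw [hemp, Set.ncard_empty, Nat.cast_zero]
    have h1 := half_le_one_sub (mul_pos hh (ℓ.pos e)).le
    have h2 : 1 ≤ Real.exp (h * K) * Real.exp (h * s) := by
      rw [← Real.exp_add]
      exact Real.one_le_exp (by nlinarith)
    nlinarith
  | succ n ih =>
    rcases lt_or_ge s 0 with hs | hs
    · have : (0 : ℝ) ≤ n * m := by positivity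
      exact ih e s (by linarith)
    · have ih' := fun e' => ih e' (s - ℓ.toFun e') (by push_cast at hn; linarith [hml e'])
      obtain ⟨hfin, hcard⟩ := ncard_continuations hG ℓ e hs fun e' => (ih' e').1
      refine ⟨hfin, fun _ => ?_, fun _ => ?_⟩
      · rw [hcard]
        push_cast
        have hle := Finset.sum_le_sum fun e' (_ : e' ∈ Finset.univ.erase (G.bar e)) =>
          (ih' e').2.1 (by linarith [hK e'])
        rw [Finset.sum_sub_distrib, ← Finset.mul_sum, sum_exp_mul_eq ℓ hsum, Finset.sum_const,
          Finset.card_erase_of_mem (Finset.mem_univ _), Finset.card_univ] at hle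
        have hc : (2 : ℝ) ≤ (Fintype.card G.E - 1 : ℕ) := by
          have := two_lt_card ℓ hh hsum
          exact_mod_cast (by omega : 2 ≤ Fintype.card G.E - 1)
        simp only [nsmul_eq_mul, mul_one] at hle
        linarith
      · rcases le_or_gt K s with hKs | hKs
        · rw [hcard]
          push_cast
          have hle := Finset.sum_le_sum fun e' (_ : e' ∈ Finset.univ.erase (G.bar e)) =>
            (ih' e').2.2 (by linarith [hK e'])
          rw [← Finset.mul_sum, sum_exp_mul_eq ℓ hsum] at hle
          linarith
        · have h1 : (1 : ℝ) ≤ (continuations ℓ e s).ncard := by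
            rw [hcard]
            push_cast
            have : (0 : ℝ) ≤ ∑ e' ∈ Finset.univ.erase (G.bar e),
              ((continuations ℓ e' (s - ℓ.toFun e')).ncard : ℝ) := by positivity
            linarith
          have h2 : Real.exp (-(h * K)) * Real.exp (h * s) ≤ 1 := by
            rw [← Real.exp_add, Real.exp_le_one_iff]
            nlinarith
          have h3 : 0 < 1 / (Real.exp (h * ℓ.toFun e) + 1) := by positivity
          have h4 := half_le_one_sub (mul_pos hh (ℓ.pos e)).le
          have h5 : 0 < Real.exp (-(h * K)) * Real.exp (h * s) := by positivity
          nlinarith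

/-! ### Entropy of graphs with one vertex -/

/-- Two-sided exponential bounds on a counting function determine its exponential growth rate. -/
lemma tendsto_log_div_of_bounds {N : ℝ → ℝ} {h c C : ℝ} (hc : 0 < c)
    (hlow : ∀ᶠ t in atTop, c * Real.exp (h * t) ≤ N t)
    (hupp : ∀ᶠ t in atTop, N t ≤ C * Real.exp (h * t)) :
    Tendsto (fun t : ℝ => (1 / t) * Real.log (N t)) atTop (𝓝 h) := by
  have hC : 0 < C := by
    obtain ⟨t, h1, h2⟩ := (hlow.and hupp).exists
    have h3 := Real.exp_pos (h * t)
    by_contra hcon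
    nlinarith
  have lim : ∀ a : ℝ, Tendsto (fun t : ℝ => (1 / t) * Real.log a + h) atTop (𝓝 h) := by
    intro a
    have := ((tendsto_inv_atTop_zero (𝕜 := ℝ)).mul_const (Real.log a)).add_const h
    simpa [one_div] using this
  have ident : ∀ a t : ℝ, 0 < a → 0 < t →
      (1 / t) * Real.log (a * Real.exp (h * t)) = (1 / t) * Real.log a + h := by
    intro a t ha ht
    rw [Real.log_mul ha.ne' (Real.exp_pos _).ne', Real.log_exp]
    field_simp
  refine tendsto_of_tendsto_of_tendsto_of_le_of_le' (lim c) (lim C) ?_ ?_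
  · filter_upwards [hlow, eventually_gt_atTop 0] with t h1 ht
    rw [← ident c t hc ht]
    have : 0 < c * Real.exp (h * t) := by positivity
    gcongr
  · filter_upwards [hlow, hupp, eventually_gt_atTop 0] with t h1 h2 ht
    rw [← ident C t hC ht]
    have : 0 < N t := lt_of_lt_of_le (by positivity) h1
    gcongr

/-- In a graph with one vertex every path without backtracking can be closed up to a circuit by
one more edge. -/
lemma exists_isCircuit_append [Fintype G.E] (hG : ∀ e e', G.τ e = G.o e')
    (hcard : 2 < Fintype.card G.E) {e : G.E} {w : List G.E} (hw : (e :: w).IsChain G.Follows) :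
    ∃ a, G.IsCircuit (e :: w ++ [a]) := by
  classical
  -- The closing edge has to avoid only the reverses of the last and of the first edge.
  obtain ⟨a, ha⟩ : ∃ a, a ∉ ({G.bar ((e :: w).getLast (by simp)), G.bar e} : Finset G.E) := by
    by_contra! hcon
    have := Finset.card_le_card (fun x _ => hcon x : Finset.univ ⊆ _)
    have h2 := Finset.card_le_two (a := G.bar ((e :: w).getLast (by simp))) (b := G.bar e)
    rw [Finset.card_univ] at this
    omega
  simp only [Finset.mem_insert, Finset.mem_singleton, not_or] at ha
  refine ⟨a, by simp, ?_, ?_⟩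
  · rw [List.isChain_append]
    refine ⟨hw, by simp, ?_⟩
    intro x hx y hy
    rw [List.getLast?_eq_getLast_of_ne_nil (by simp)] at hx
    simp only [Option.mem_def, Option.some.injEq, List.head?_cons] at hx hy
    rw [← hx, ← hy, follows_iff hG]
    exact ha.1
  · rw [follows_iff hG]
    simp only [List.cons_append, List.head_cons]
    intro h
    apply ha.2
    rw [h]
    simp [G.bar_bar]

/-- The entropy of a finite graph with one vertex solves an explicit equation. -/
theorem hasEntropy_of_sum_eq_one [Fintype G.E] (hG : ∀ e e', G.τ e = G.o e')
    (ℓ : G.LengthFunction) {h : ℝ} (hh : 0 < h)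
    (hsum : ∑ e, 1 / (Real.exp (h * ℓ.toFun e) + 1) = 1) : G.HasEntropy ℓ h := by
  classical
  have hcard := two_lt_card ℓ hh hsum
  have : Nonempty G.E := Fintype.card_pos_iff.mp (by omega)
  obtain ⟨eK, hK⟩ := Finite.exists_max ℓ.toFun
  obtain ⟨em, hm⟩ := Finite.exists_min ℓ.toFun
  set K := ℓ.toFun eK with hKdef
  have hb := continuations_bounds hG ℓ hh hsum (ℓ.pos em) hm hK
  have hsub : ∀ t, G.circuits ℓ t ⊆ ⋃ e, continuations ℓ e t := by
    rintro t γ ⟨hγ, hle⟩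
    obtain ⟨a, w, rfl⟩ := List.exists_cons_of_ne_nil hγ.ne_nil
    -- Reversal has no fixed point, so `a` may follow itself and the whole circuit is a continuation
    -- of its own first edge.
    refine Set.mem_iUnion.mpr ⟨a, ?_, hle⟩
    rw [List.isChain_cons_cons]
    refine ⟨?_, hγ.chain⟩
    rw [follows_iff hG]
    exact fun h => G.bar_ne a h.symm
  have hfin : ∀ t, (⋃ e, continuations ℓ e t).Finite :=
    fun t => Set.finite_iUnion fun e => (hb e t).1
  refine tendsto_log_div_of_bounds (c := Real.exp (-(h * K)) * (1 / 2) * Real.exp (-(h * (2 * K))))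
    (C := Fintype.card G.E * (2 * Real.exp (h * K))) (by positivity) ?_ ?_
  · filter_upwards [eventually_ge_atTop (2 * K)] with t ht
    -- The margin `2 * K` pays for the initial edge `eK` and for the closing edge.
    obtain ⟨-, -, hlow⟩ := hb eK (t - 2 * K)
    have hchoice : ∀ w ∈ continuations ℓ eK (t - 2 * K), ∃ a, G.IsCircuit (eK :: w ++ [a]) :=
      fun w hw => exists_isCircuit_append hG hcard hw.1
    choose! a ha using hchoice
    have hle : (continuations ℓ eK (t - 2 * K)).ncard ≤ (G.circuits ℓ t).ncard := by
      refine Set.ncard_le_ncard_of_injOn (fun w => eK :: w ++ [a w]) ?_ ?_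
        ((hfin t).subset (hsub t))
      · intro w hw
        refine ⟨ha w hw, ?_⟩
        have := hw.2
        simp only [LengthFunction.length_append, LengthFunction.length_cons,
          LengthFunction.length_nil]
        linarith [hK (a w)]
      · intro v _ w _ hvw
        have := congrArg List.dropLast hvw
        rw [List.dropLast_concat, List.dropLast_concat] at this
        exact (List.cons.inj this).2
    have hle' : ((continuations ℓ eK (t - 2 * K)).ncard : ℝ) ≤ (G.circuits ℓ t).ncard := by
      exact_mod_cast hle
    refine le_trans ?_ ((hlow (by linarith)).trans hle')
    have hq := half_le_one_sub (mul_pos hh (ℓ.pos eK)).le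
    rw [mul_assoc, ← Real.exp_add, mul_assoc,
      show -(h * (2 * K)) + h * t = h * (t - 2 * K) by ring]
    gcongr
  · filter_upwards [eventually_ge_atTop (-K)] with t ht
    have h1 : (G.circuits ℓ t).ncard ≤ ∑ e, (continuations ℓ e t).ncard := by
      exact (Set.ncard_le_ncard (hsub t) (hfin t)).trans (Set.ncard_iUnion_le_of_fintype _)
    have h2 : ((G.circuits ℓ t).ncard : ℝ) ≤ ∑ e, ((continuations ℓ e t).ncard : ℝ) := by
      exact_mod_cast h1
    refine h2.trans ?_
    rw [mul_assoc, ← nsmul_eq_mul, ← Finset.card_univ, ← Finset.sum_const]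
    refine Finset.sum_le_sum fun e _ => ((hb e t).2.1 ht).trans ?_
    have h3 : 0 < 1 / (Real.exp (h * ℓ.toFun e) + 1) := by positivity
    have h5 : 0 < Real.exp (h * K) * Real.exp (h * t) := by positivity
    nlinarith

/-! ### The entropy equation and the loss of one petal -/

/-- Intermediate values: the sum is continuous in `h` and tends to 0. This turns an inequality at
`B` into a lower bound for an entropy. -/
lemma exists_sum_eq_one {ι : Type*} [Fintype ι] {x : ι → ℝ} (hx : ∀ i, 0 < x i) {B : ℝ}
    (hB : 1 ≤ ∑ i, 1 / (Real.exp (B * x i) + 1)) :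
    ∃ h, B ≤ h ∧ ∑ i, 1 / (Real.exp (h * x i) + 1) = 1 := by
  have hcont : Continuous fun h : ℝ => ∑ i, 1 / (Real.exp (h * x i) + 1) := by
    refine continuous_finsetSum _ fun i _ => ?_
    refine Continuous.div (by fun_prop) (by fun_prop) fun h => ?_
    positivity
  have hlim : Tendsto (fun h : ℝ => ∑ i, 1 / (Real.exp (h * x i) + 1)) atTop (𝓝 0) := by
    have : Tendsto (fun h : ℝ => ∑ i, 1 / (Real.exp (h * x i) + 1)) atTop
        (𝓝 (∑ _i : ι, (0 : ℝ))) := by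
      refine tendsto_finsetSum _ fun i _ => ?_
      refine Tendsto.div_atTop tendsto_const_nhds ?_
      refine tendsto_atTop_add_const_right _ _ (Real.tendsto_exp_atTop.comp ?_)
      exact tendsto_id.atTop_mul_const (hx i)
    simpa using this
  obtain ⟨t, ht, htB⟩ :=
    ((hlim.eventually_le_const zero_lt_one).and (eventually_ge_atTop B)).exists
  obtain ⟨h, hh, heq⟩ := intermediate_value_Icc' htB hcont.continuousOn ⟨ht, hB⟩
  exact ⟨h, hh.1, heq⟩

/-- With `y = exp x` and `d = (1 - B) * (y - 1)`, convexity bounds the right side below by `1 / (y +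
1 - d)`. The left side is `(y + 1 + d) / (y + 1) ^ 2`, and `(y + 1 + d) * (y + 1 - d) ≤ (y + 1) ^
2`. -/
lemma le_one_div_exp_mul_add_one {B x : ℝ} (hB0 : 0 ≤ B) (hB1 : B ≤ 1) :
    1 / (Real.exp x + 1) +
        (1 - B) * (1 / (Real.exp x + 1)) * (1 - 2 * (1 / (Real.exp x + 1))) ≤
      1 / (Real.exp (B * x) + 1) := by
  have hconv : Real.exp (B * x) ≤ B * Real.exp x + (1 - B) := by
    have := convexOn_exp.2 (Set.mem_univ x) (Set.mem_univ 0) hB0 (sub_nonneg.mpr hB1) (by ring)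
    simpa using this
  have hx := Real.exp_pos x
  have hBx := Real.exp_pos (B * x)
  refine le_trans ?_ (one_div_le_one_div_of_le (by positivity) (add_le_add_left hconv 1))
  set y := Real.exp x
  have hpos : 0 < B * y + (1 - B) + 1 := by linarith
  have hid : 1 / (y + 1) + (1 - B) * (1 / (y + 1)) * (1 - 2 * (1 / (y + 1))) =
      (y + 1 + (1 - B) * (y - 1)) / (y + 1) ^ 2 := by
    field_simp
    ring
  rw [hid, div_le_div_iff₀ (by positivity) hpos]
  nlinarith [sq_nonneg ((1 - B) * (y - 1))]

/-- Dropping the largest of the `x i` from a solution of the entropy equation at `1` leaves a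
supersolution at `B`. -/
lemma half_le_sum_erase {r : ℕ} (hr : 2 ≤ r) {x : Fin r → ℝ}
    (hsum : ∑ i, 1 / (Real.exp (x i) + 1) = 1 / 2) {k : Fin r} (hk : ∀ i, x i ≤ x k)
    {B : ℝ} (hB0 : 0 ≤ B) (hB1 : B ≤ 1) (hB : (r : ℝ) / (r - 1) ^ 2 ≤ 1 - B) :
    1 / 2 ≤ ∑ i ∈ Finset.univ.erase k, 1 / (Real.exp (B * x i) + 1) := by
  set a : Fin r → ℝ := fun i => 1 / (Real.exp (x i) + 1) with ha
  have hr' : (2 : ℝ) ≤ r := by exact_mod_cast hr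
  have hm : ∀ i, a k ≤ a i := fun i => by
    have := hk i
    simp only [ha]
    gcongr
  have hpos : ∀ i, 0 < a i := fun i => by simp only [ha]; positivity
  have hcard : ∀ i : Fin r, ((Finset.univ.erase i).card : ℝ) = r - 1 := fun i => by
    rw [Finset.card_erase_of_mem (Finset.mem_univ _), Finset.card_univ, Fintype.card_fin,
      Nat.cast_sub (by omega), Nat.cast_one]
  have herase : ∀ i, ∑ j ∈ Finset.univ.erase i, a j = 1 / 2 - a i := fun i => by
    rw [Finset.sum_erase_eq_sub (Finset.mem_univ i), hsum]
  have hge : ∀ i, (r - 1) * a k ≤ 1 / 2 - a i := fun i => by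
    rw [← herase, ← hcard i, ← nsmul_eq_mul]
    exact Finset.card_nsmul_le_sum _ _ _ fun j _ => hm j
  -- The gain factor `1 - 2 * a i` is twice the sum of the other terms, hence at least `2 * (r - 1)
  -- * a k`. This is proportional to the loss `a k`.
  have hterm : ∀ i ∈ Finset.univ.erase k,
      a i * (1 + (1 - B) * (2 * ((r - 1) * a k))) ≤ 1 / (Real.exp (B * x i) + 1) := by
    intro i _
    refine le_trans ?_ (le_one_div_exp_mul_add_one hB0 hB1)
    change _ ≤ a i + (1 - B) * a i * (1 - 2 * a i)
    have h1 := mul_le_mul_of_nonneg_left (hge i)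
      (mul_nonneg (sub_nonneg.mpr hB1) (hpos i).le)
    linarith
  refine le_trans ?_ (Finset.sum_le_sum hterm)
  rw [← Finset.sum_mul, herase]
  have hk2 := hge k
  have hkp := hpos k
  rw [div_le_iff₀ (by nlinarith)] at hB
  -- After division by `a k`, this says that the gain covers the loss. It follows from `a k ≤ 1 / (2
  -- * r)` and the hypothesis on `B`.
  have h1 : 1 ≤ 2 * (1 - B) * (r - 1) * (1 / 2 - a k) := by
    have h2 : (r - 1 : ℝ) ≤ 2 * r * (1 / 2 - a k) := by linarith
    have h3 : (r - 1 : ℝ) * ((r : ℝ) * 1) ≤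
        (r - 1 : ℝ) * (r * (2 * (1 - B) * (r - 1) * (1 / 2 - a k))) := by
      have h4 := mul_le_mul_of_nonneg_left h2
        (mul_nonneg (sub_nonneg.mpr hB1) (sq_nonneg (r - 1 : ℝ)))
      nlinarith
    have h5 := le_of_mul_le_mul_left h3 (by linarith)
    exact le_of_mul_le_mul_left h5 (by linarith)
  have h6 := mul_le_mul_of_nonneg_left h1 hkp.le
  linarith

/-! ### Subgraphs and roses -/

lemma HasEntropy.unique {ℓ : G.LengthFunction} {h h' : ℝ} (hh : G.HasEntropy ℓ h)
    (hh' : G.HasEntropy ℓ h') : h = h' :=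
  tendsto_nhds_unique hh hh'

/-- There are finitely many subgraphs, each with at most one entropy. Finiteness makes the supremum
a maximum. -/
lemma finite_subgraphEntropies [Finite G.V] [Finite G.E] (ℓ : G.LengthFunction) :
    (G.subgraphEntropies ℓ).Finite := by
  have : Finite G.Subgraph := by
    refine Finite.of_injective (fun H : G.Subgraph => (H.verts, H.edges)) ?_
    rintro ⟨⟩ ⟨⟩ h
    simp only [Prod.mk.injEq] at h
    obtain ⟨rfl, rfl⟩ := h
    rfl
  have hsub : G.subgraphEntropies ℓ ⊆
      ⋃ H : G.Subgraph, {h | H.toGraph.HasEntropy (ℓ.restrict H) h} := by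
    rintro h ⟨H, -, hH⟩
    exact Set.mem_iUnion.mpr ⟨H, hH⟩
  refine (Set.finite_iUnion fun H => ?_).subset hsub
  exact Set.Subsingleton.finite fun h hh h' hh' => HasEntropy.unique hh hh'

instance (r : ℕ) : Fintype (rose r).E := inferInstanceAs (Fintype (Fin r × Bool))

instance (r : ℕ) : Finite (rose r).V := inferInstanceAs (Finite Unit)

/-- The subgraph of the rose that is obtained by removing a petal. -/
def removePetal {r : ℕ} (k : Fin r) : (rose r).Subgraph where
  verts := Set.univ
  edges := {e | e.1 ≠ k}
  o_mem _ _ := trivial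
  τ_mem _ _ := trivial
  bar_mem _ he := he

lemma removePetal_isProper {r : ℕ} (k : Fin r) : (removePetal k).IsProper := by
  rintro ⟨-, h⟩
  have : ((k, true) : (rose r).E) ∈ (removePetal k).edges := h ▸ Set.mem_univ _
  exact this rfl

lemma sum_rose {r : ℕ} (ℓ : (rose r).LengthFunction) (s : Finset (Fin r)) (f : ℝ → ℝ) :
    ∑ e ∈ s ×ˢ (Finset.univ : Finset Bool), f (ℓ.toFun e) =
      2 * ∑ i ∈ s, f (ℓ.toFun (i, true)) := by
  rw [Finset.sum_product, Finset.mul_sum]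
  refine Finset.sum_congr rfl fun i _ => ?_
  have : ℓ.toFun (i, false) = ℓ.toFun (i, true) := ℓ.bar_eq (i, true)
  rw [Fintype.sum_bool, this, two_mul]

/-- Converse of `hasEntropy_of_sum_eq_one` at entropy 1: the sum is `r > 1` at `h = 0`, so there is
a positive root. That root is the entropy, and the entropy is unique. -/
lemma rose_sum_eq_one {r : ℕ} (hr : 2 ≤ r) {ℓ : (rose r).LengthFunction}
    (hℓ : ℓ ∈ (rose r).unitEntropy) : ∑ e, 1 / (Real.exp (ℓ.toFun e) + 1) = 1 := by
  have hcard : Fintype.card (rose r).E = 2 * r := by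
    change Fintype.card (Fin r × Bool) = _
    simp [mul_comm]
  have hr' : (2 : ℝ) ≤ r := by exact_mod_cast hr
  have h0 : 1 < ∑ e, 1 / (Real.exp (0 * ℓ.toFun e) + 1) := by
    simp only [zero_mul, Real.exp_zero, Finset.sum_const, Finset.card_univ, hcard]
    norm_num
    linarith
  obtain ⟨h, hh, heq⟩ := exists_sum_eq_one ℓ.pos h0.le
  have hpos : 0 < h := lt_of_le_of_ne hh (by rintro rfl; linarith)
  have h1 : h = 1 :=
    HasEntropy.unique (hasEntropy_of_sum_eq_one (fun _ _ => rfl) ℓ hpos heq) hℓ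
  simpa [h1] using heq

lemma unitEntropy_rose_nonempty {r : ℕ} (hr : 2 ≤ r) : (rose r).unitEntropy.Nonempty := by
  have hr' : (2 : ℝ) ≤ r := by exact_mod_cast hr
  -- With all lengths equal to `log (2 * r - 1)`, each of the `2 * r` directed edges contributes `1
  -- / (2 * r)`.
  refine ⟨⟨fun _ => Real.log (2 * r - 1), fun _ => Real.log_pos (by linarith), fun _ => rfl⟩, ?_⟩
  refine hasEntropy_of_sum_eq_one (fun _ _ => rfl) _ zero_lt_one ?_
  have hcard : Fintype.card (rose r).E = 2 * r := by
    change Fintype.card (Fin r × Bool) = _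
    simp [mul_comm]
  simp only [one_mul, Finset.sum_const, Finset.card_univ, hcard,
    Real.exp_log (show (0 : ℝ) < 2 * r - 1 by linarith)]
  rw [nsmul_eq_mul]
  push_cast
  field_simp
  ring

/-- Removing the longest petal of a rose of unit entropy leaves entropy at least `B`, if
`r / (r - 1) ^ 2 ≤ 1 - B`. -/
theorem exists_hasEntropy_removePetal {r : ℕ} (hr : 2 ≤ r) {ℓ : (rose r).LengthFunction}
    (hℓ : ℓ ∈ (rose r).unitEntropy) {B : ℝ} (hB0 : 0 < B) (hB1 : B ≤ 1)
    (hB : (r : ℝ) / (r - 1) ^ 2 ≤ 1 - B) :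
    ∃ k : Fin r, ∃ h, (removePetal k).toGraph.HasEntropy (ℓ.restrict (removePetal k)) h ∧
      B ≤ h := by
  classical
  have : Nonempty (Fin r) := ⟨⟨0, by omega⟩⟩
  obtain ⟨k, hk⟩ := Finite.exists_max fun i : Fin r => ℓ.toFun (i, true)
  let inst : Fintype (removePetal k).toGraph.E :=
    inferInstanceAs (Fintype {e : Fin r × Bool // e.1 ≠ k})
  have hsum : ∑ i : Fin r, 1 / (Real.exp (ℓ.toFun (i, true)) + 1) = 1 / 2 := by
    have h1 := rose_sum_eq_one hr hℓ
    have h2 := sum_rose ℓ Finset.univ fun x => 1 / (Real.exp x + 1)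
    rw [Finset.univ_product_univ] at h2
    have h3 := h2.symm.trans h1
    linarith
  have hsub : ∑ e : (removePetal k).toGraph.E,
      1 / (Real.exp (B * (ℓ.restrict (removePetal k)).toFun e) + 1) =
      2 * ∑ i ∈ Finset.univ.erase k, 1 / (Real.exp (B * ℓ.toFun (i, true)) + 1) := by
    rw [← sum_rose ℓ (Finset.univ.erase k) fun x => 1 / (Real.exp (B * x) + 1)]
    symm
    refine Finset.sum_subtype (p := fun e : Fin r × Bool => e.1 ≠ k)
      (Finset.univ.erase k ×ˢ Finset.univ) (by simp)
      fun e => 1 / (Real.exp (B * ℓ.toFun e) + 1)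
  have hhalf := half_le_sum_erase hr hsum hk hB0.le hB1 hB
  obtain ⟨h, hle, heq⟩ := exists_sum_eq_one (ℓ.restrict (removePetal k)).pos
    (B := B) (by rw [hsub]; linarith)
  exact ⟨k, h, hasEntropy_of_sum_eq_one (fun _ _ => rfl) _ (hB0.trans_le hle) heq, hle⟩

/-- Since `exp 4` is about 54.6, the least `r` with `2 * r - 3 > exp 4` is 29, the threshold in the
definition of `B_r`. -/
lemma four_lt_log {x : ℝ} (hx : 55 ≤ x) : 4 < Real.log x := by
  rw [Real.lt_log_iff_exp_lt (by linarith)]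
  have h1 : Real.exp 4 = Real.exp 1 ^ 4 := by rw [← Real.exp_nat_mul]; norm_num
  have h2 : Real.exp 1 ^ 4 < 2.7182818286 ^ 4 := by
    gcongr
    exact Real.exp_one_lt_d9
  rw [h1]
  refine h2.trans (lt_of_lt_of_le ?_ hx)
  norm_num

end SerreGraph

theorem proposition4p2 :
    ∃ B : ℕ → ℝ,
      (∀ r : ℕ, B r = if r < 29 then 1 / 5 else 1 - 4 / Real.log (2 * (r : ℝ) - 3)) ∧
      (∀ r : ℕ, 3 ≤ r →
        0 < B r ∧
        (∀ ℓ ∈ (SerreGraph.rose r).unitEntropy,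
          (∃ H : (SerreGraph.rose r).Subgraph, H.IsProper ∧
            ∃ h : ℝ, H.toGraph.HasEntropy (ℓ.restrict H) h ∧ B r ≤ h) ∧
          IsGreatest ((SerreGraph.rose r).subgraphEntropies ℓ)
            ((SerreGraph.rose r).entropySup ℓ) ∧
          B r ≤ (SerreGraph.rose r).entropySup ℓ) ∧
        (SerreGraph.rose r).unitEntropy.Nonempty ∧
        B r ≤ (SerreGraph.rose r).entropyInf) ∧
      Tendsto B atTop (𝓝 1) := by
  refine ⟨fun r => if r < 29 then 1 / 5 else 1 - 4 / Real.log (2 * (r : ℝ) - 3),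
    fun _ => rfl, fun r hr => ?_, ?_⟩
  · set B : ℝ := if r < 29 then 1 / 5 else 1 - 4 / Real.log (2 * (r : ℝ) - 3) with hBdef
    have hr' : (3 : ℝ) ≤ r := by exact_mod_cast hr
    obtain ⟨hB0, hB1, hB⟩ : 0 < B ∧ B ≤ 1 ∧ (r : ℝ) / (r - 1) ^ 2 ≤ 1 - B := by
      have hsq : (0 : ℝ) < (r - 1) ^ 2 := by nlinarith
      by_cases h29 : r < 29
      · rw [hBdef, if_pos h29, div_le_iff₀ hsq]
        -- The tightest case is `r = 3`, where `3 / 4 ≤ 4 / 5`.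
        exact ⟨by norm_num, by norm_num, by nlinarith⟩
      · have h29' : (29 : ℝ) ≤ r := by exact_mod_cast not_lt.mp h29
        have hlog : 4 < Real.log (2 * (r : ℝ) - 3) := SerreGraph.four_lt_log (by linarith)
        have hlog' := Real.log_le_sub_one_of_pos (show (0 : ℝ) < 2 * r - 3 by linarith)
        rw [hBdef, if_neg h29]
        refine ⟨?_, ?_, ?_⟩
        · rw [sub_pos, div_lt_one (by linarith)]
          exact hlog
        · linarith [div_nonneg zero_le_four (show 0 ≤ Real.log (2 * (r : ℝ) - 3) by linarith)]
        · rw [sub_sub_cancel, div_le_div_iff₀ hsq (by linarith)]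
          -- The crude bound `log (2 * r - 3) ≤ 2 * r - 4` suffices, as `r * (2 * r - 4) ≤ 4 * (r -
          -- 1) ^ 2`.
          nlinarith
    have hexists : ∀ ℓ ∈ (SerreGraph.rose r).unitEntropy,
        ∃ H : (SerreGraph.rose r).Subgraph, H.IsProper ∧
          ∃ h : ℝ, H.toGraph.HasEntropy (ℓ.restrict H) h ∧ B ≤ h := by
      intro ℓ hℓ
      obtain ⟨k, h⟩ :=
        SerreGraph.exists_hasEntropy_removePetal (by omega) hℓ hB0 hB1 hB
      exact ⟨_, SerreGraph.removePetal_isProper k, h⟩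
    have hsup : ∀ ℓ ∈ (SerreGraph.rose r).unitEntropy,
        B ≤ (SerreGraph.rose r).entropySup ℓ := by
      intro ℓ hℓ
      obtain ⟨H, hH, h, hent, hle⟩ := hexists ℓ hℓ
      exact hle.trans (le_csSup (SerreGraph.finite_subgraphEntropies ℓ).bddAbove ⟨H, hH, hent⟩)
    -- Needed for the infimum as well: over the empty set it would be 0, below `B`.
    have hne := SerreGraph.unitEntropy_rose_nonempty (r := r) (by omega)
    refine ⟨hB0, fun ℓ hℓ => ⟨hexists ℓ hℓ, ?_, hsup ℓ hℓ⟩, hne, ?_⟩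
    · have hfin := SerreGraph.finite_subgraphEntropies ℓ
      obtain ⟨H, hH, h, hent, -⟩ := hexists ℓ hℓ
      exact ⟨Set.Nonempty.csSup_mem ⟨h, H, hH, hent⟩ hfin,
        fun h' hh' => le_csSup hfin.bddAbove hh'⟩
    · refine le_csInf (hne.image _) ?_
      rintro _ ⟨ℓ, hℓ, rfl⟩
      exact hsup ℓ hℓ
  · have hlim : Tendsto (fun r : ℕ => 1 - 4 / Real.log (2 * (r : ℝ) - 3)) atTop (𝓝 (1 - 0)) := by
      refine tendsto_const_nhds.sub (tendsto_const_nhds.div_atTop (Real.tendsto_log_atTop.comp ?_))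
      refine tendsto_atTop_add_const_right _ _ ?_
      exact tendsto_natCast_atTop_atTop.const_mul_atTop two_pos
    rw [sub_zero] at hlim
    refine hlim.congr' ?_
    filter_upwards [eventually_ge_atTop 29] with r hr
    rw [if_neg (by omega)]
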